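/- Let $K$ be a number field with ring of integers $\mathcal{O}_K$. For a prime $\ell$ and an integer $f\ge 1$, let $\Pi_{\ell^f}(K)$ be the product of all maximal ideals of $\mathcal{O}_K$ of absolute norm $\ell^f$ (the unit ideal if there are none). The field $K$ is called a Pólya field if $\Pi_{\ell^f}(K)$ is principal for every prime $\ell$ and every $f\ge 1$. **Theorem 1.2.** Let $p,q,r,s$ be primes with $p\equiv q\equiv 3 \pmod 4$ and $r\equiv s\equiv 1\pmod 4$, and let $\left(\frac{\cdot}{\cdot}\right)$ denote the Legendre symbol. Then $\mathbb{Q}(\sqrt{p},\sqrt{qrs})$ is a Pólya field in the following cases. (i) $\left(\frac{2}{r}\right)=\left(\frac{2}{s}\right)=-1$ and one of the following conditions holds: - C1: $\left(\frac{q}{r}\right)=\left(\frac{q}{s}\right)=\left(\frac{rs}{p}\right)=-1$; - C2: $\left(\frac{rs}{q}\right)=\left(\frac{r}{p}\right)=\left(\frac{s}{p}\right)=-1$. (ii) $\left(\frac{2}{r}\right)=-\left(\frac{2}{s}\right)=1$ and one of the following conditions holds: - C3: $\left(\frac{r}{s}\right)=\left(\frac{q}{s}\right)=\left(\frac{r}{p}\right)=-1=-\left(\frac{r}{q}\right)$;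 - C4: $\left(\frac{r}{q}\right)=\left(\frac{r}{s}\right)=\left(\frac{r}{p}\right)=-1=-\left(\frac{s}{p}\right)$; - C5: $\left(\frac{r}{q}\right)=\left(\frac{r}{p}\right)=\left(\frac{pq}{s}\right)=-1=-\left(\frac{r}{s}\right)$. -/

import Mathlib

open scoped NumberField

/-- The Ostrowski ideal of norm `n` of a number field `K`: the product of all maximal ideals of the
ring of integers of `K` whose absolute norm is `n`. The product is finite
(`finite_maximal_absNorm`), and it is the unit ideal if there is no such maximal ideal. -/
noncomputable def ostrowskiIdeal (K : Type*) [Field K] [NumberField K] (n : ℕ) : Ideal (𝓞 K) :=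
  ∏ᶠ m ∈ {m : Ideal (𝓞 K) | m.IsMaximal ∧ Ideal.absNorm m = n}, m

theorem finite_maximal_absNorm (K : Type*) [Field K] [NumberField K] (n : ℕ) :
    {m : Ideal (𝓞 K) | m.IsMaximal ∧ Ideal.absNorm m = n}.Finite :=
  (Ideal.finite_setOfPred_absNorm_eq n).subset fun _ hm => hm.2

/-- A number field is a Pólya field if its Ostrowski ideals are principal for all prime powers. -/
def IsPolyaField (K : Type*) [Field K] [NumberField K] : Prop :=
  ∀ ℓ f : ℕ, ℓ.Prime → 0 < f → (ostrowskiIdeal K (ℓ ^ f)).IsPrincipal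

/-- The field `ℚ(√a, √b)`, as a subfield of `ℝ`. -/
noncomputable def adjoinSqrts (a b : ℕ) : IntermediateField ℚ ℝ :=
  IntermediateField.adjoin ℚ {√(a : ℝ), √(b : ℝ)}

theorem isIntegral_sqrt_natCast (a : ℕ) : IsIntegral ℚ √(a : ℝ) :=
  IsIntegral.of_pow two_pos (by
    rw [Real.sq_sqrt a.cast_nonneg]
    exact isIntegral_algebraMap (R := ℚ) (x := (a : ℚ)))

instance adjoinSqrts_numberField (a b : ℕ) : NumberField (adjoinSqrts a b) where
  to_charZero := inferInstance
  to_finiteDimensional := by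
    have h : FiniteDimensional ℚ
        (IntermediateField.adjoin ℚ ({√(a : ℝ), √(b : ℝ)} : Set ℝ)) :=
      IntermediateField.finiteDimensional_adjoin fun x hx => by
        rcases hx with rfl | rfl <;> exact isIntegral_sqrt_natCast _
    exact h

/-! ### Ostrowski ideals and ramification in Galois number fields. -/

section Ostrowski

open Ideal Pointwise

variable {K : Type*} [Field K] [NumberField K]

/-! In a Galois field a nontrivial Ostrowski ideal above `ℓ`, raised to the ramification index, is
`(ℓ)`. In `K = ℚ(√p, √(qrs))` every inertia group has order at most 2, and only 2, `p`, `q`, `r`,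
`s` can ramify. So `K` is Pólya once each of these is a unit times a square in `𝓞 K`
(`isPrincipal_ostrowskiIdeal_of_card_inertia`, `isPolyaField_adjoinSqrts`). For `p` this is clear,
and for `qrs` too, so two of `q`, `r`, `s` suffice besides 2.

Such squares come from units. If `x ^ 2 - n * y ^ 2 = 1`, then `(x + 1 + y√n) ^ 2 = 2(x + 1)(x +
y√n)`, so `2(x + 1)` is a square up to a unit. Factoring `(x - 1)(x + 1)` identifies its class as `a
* e`, with `a * b = n`, `e ∈ {1, 2}` and `a * u ^ 2 - b * v ^ 2 = e`; minimality of the fundamental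
solution makes the class nontrivial (`exists_pell_descent`, `IsSquareUpToUnit.of_pell`).

Taking `n = p` settles 2. For `n = qrs` and `n = pqrs`, reading the equation modulo `r` and `s`
restricts the possible `a` by Legendre symbols (`splitting_of_three_primes`,
`splitting_of_four_primes`). Under each of C1–C5 the two units yield different primes among `q`,
`r`, `s`. -/

/-- A maximal ideal of prime power norm lies over that prime. -/
theorem liesOver_of_absNorm_eq_prime_pow {ℓ f : ℕ} (hℓ : ℓ.Prime) {P : Ideal (𝓞 K)}
    (hP : P.IsMaximal) (hN : absNorm P = ℓ ^ f) : P.LiesOver (span {(ℓ : ℤ)}) := by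
  have hp : (span {(ℓ : ℤ)}).IsMaximal :=
    PrincipalIdealRing.isMaximal_of_irreducible (Nat.prime_iff_prime_int.mp hℓ).irreducible
  have hmem : (ℓ : 𝓞 K) ∈ P := by
    have h := absNorm_mem P
    rw [hN, Nat.cast_pow] at h
    exact hP.isPrime.mem_of_pow_mem _ h
  refine ⟨hp.eq_of_le (comap_ne_top _ hP.ne_top) ?_⟩
  rw [span_singleton_le_iff_mem]
  simpa using hmem

/-- In a Galois number field, the power of a nontrivial Ostrowski ideal given by the ramification
index is generated by the underlying rational prime. -/
theorem ostrowskiIdeal_pow_ramificationIdxIn [IsGalois ℚ K] {ℓ f : ℕ} (hℓ : ℓ.Prime)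
    {P : Ideal (𝓞 K)} (hP : P.IsMaximal) (hN : absNorm P = ℓ ^ f) :
    ostrowskiIdeal K (ℓ ^ f) ^ ramificationIdxIn (span {(ℓ : ℤ)}) (𝓞 K) =
      span {(ℓ : 𝓞 K)} := by
  have hp : (span {(ℓ : ℤ)}).IsMaximal :=
    PrincipalIdealRing.isMaximal_of_irreducible (Nat.prime_iff_prime_int.mp hℓ).irreducible
  have hp0 : span {(ℓ : ℤ)} ≠ 0 := by simpa using hℓ.ne_zero
  have hPl := liesOver_of_absNorm_eq_prime_pow hℓ hP hN
  -- The Galois group makes all inertia degrees above `ℓ` equal, so one prime of norm `ℓ ^ f` forces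
  -- all primes above `ℓ` to have that norm.
  have hset : {m : Ideal (𝓞 K) | m.IsMaximal ∧ absNorm m = ℓ ^ f} =
      (span {(ℓ : ℤ)}).primesOver (𝓞 K) := by
    ext Q
    constructor
    · rintro ⟨hQ, hQN⟩
      exact ⟨hQ.isPrime, liesOver_of_absNorm_eq_prime_pow hℓ hQ hQN⟩
    · rintro ⟨hQ, hQl⟩
      have hQm : Q.IsMaximal := IsMaximal.of_liesOver_isMaximal Q (span {(ℓ : ℤ)})
      refine ⟨hQm, ?_⟩
      rw [← hN, absNorm_eq_pow_inertiaDeg' Q hℓ, absNorm_eq_pow_inertiaDeg' P hℓ,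
        inertiaDeg'_eq_inertiaDeg, inertiaDeg'_eq_inertiaDeg,
        inertiaDeg_eq_of_isGaloisGroup (span {(ℓ : ℤ)}) P Q Gal(K/ℚ)]
  have hmap := map_algebraMap_eq_finsetProd_pow (R := 𝓞 K) hp0
  rw [map_span, Set.image_singleton] at hmap
  rw [ostrowskiIdeal, hset, finprod_mem_eq_toFinset_prod, ← Finset.prod_pow]
  rw [map_natCast] at hmap
  rw [hmap]
  refine Finset.prod_congr rfl fun Q hQ => ?_
  obtain ⟨_, _⟩ := Set.mem_toFinset.mp hQ
  rw [ramificationIdxIn_eq_ramificationIdx (span {(ℓ : ℤ)}) Q Gal(K/ℚ)]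

/-- An Ostrowski ideal of a Galois number field is principal as soon as every prime above
`ℓ` is unramified, or has inertia group of order at most two while `ℓ` is associated to a square. -/
theorem isPrincipal_ostrowskiIdeal_of_card_inertia [IsGalois ℚ K] {ℓ f : ℕ} (hℓ : ℓ.Prime)
    (h : ∀ P : Ideal (𝓞 K), P.IsPrime → (ℓ : 𝓞 K) ∈ P → Nat.card (P.inertia Gal(K/ℚ)) ≤ 1 ∨
      Nat.card (P.inertia Gal(K/ℚ)) ≤ 2 ∧ ∃ α : 𝓞 K, Associated (α ^ 2) (ℓ : 𝓞 K)) :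
    (ostrowskiIdeal K (ℓ ^ f)).IsPrincipal := by
  by_cases hex : ∃ P : Ideal (𝓞 K), P.IsMaximal ∧ absNorm P = ℓ ^ f
  · obtain ⟨P, hP, hN⟩ := hex
    have hp : (span {(ℓ : ℤ)}).IsMaximal :=
      PrincipalIdealRing.isMaximal_of_irreducible (Nat.prime_iff_prime_int.mp hℓ).irreducible
    have hPl := liesOver_of_absNorm_eq_prime_pow hℓ hP hN
    have hpow := ostrowskiIdeal_pow_ramificationIdxIn hℓ hP hN
    have hmem : (ℓ : 𝓞 K) ∈ P := by
      have h := absNorm_mem P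
      rw [hN, Nat.cast_pow] at h
      exact hP.isPrime.mem_of_pow_mem _ h
    rw [← card_inertia_eq_ramificationIdxIn (G := Gal(K/ℚ)) (span {(ℓ : ℤ)}) P] at hpow
    have hpos : 0 < Nat.card (P.inertia Gal(K/ℚ)) := Nat.card_pos
    have h1 : Nat.card (P.inertia Gal(K/ℚ)) = 1 → (ostrowskiIdeal K (ℓ ^ f)).IsPrincipal := by
      intro h1
      rw [h1, pow_one] at hpow
      exact ⟨_, hpow⟩
    rcases h P hP.isPrime hmem with h | ⟨h, α, hα⟩
    · exact h1 (by lia)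
    · rcases eq_or_ne (Nat.card (P.inertia Gal(K/ℚ))) 1 with h' | h'
      · exact h1 h'
      · rw [show Nat.card (P.inertia Gal(K/ℚ)) = 2 by lia,
          ← span_singleton_eq_span_singleton.mpr hα, ← span_singleton_pow] at hpow
        -- Ideals factor uniquely, so equal squares of ideals have equal roots.
        exact ⟨α, dvd_antisymm
          ((UniqueFactorizationMonoid.pow_dvd_pow_iff_dvd two_ne_zero).mp hpow.dvd)
          ((UniqueFactorizationMonoid.pow_dvd_pow_iff_dvd two_ne_zero).mp hpow.symm.dvd)⟩
  · rw [ostrowskiIdeal, show {m : Ideal (𝓞 K) | m.IsMaximal ∧ absNorm m = ℓ ^ f} = ∅ from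
      Set.eq_empty_of_forall_notMem fun P hP => hex ⟨P, hP⟩, finprod_mem_empty, one_eq_top]
    exact ⟨1, by simp⟩

end Ostrowski

/-! ### Pell descent and numbers that are squares up to units. -/

section Descent

/-- If the product of two coprime natural numbers is `n` times a square, then the numbers are
`a` and `b` times a square for some factorization `n = a * b`. -/
theorem exists_mul_sq_of_coprime_mul_eq {A B n y : ℕ} (hn : 0 < n) (h : A.Coprime B)
    (hAB : A * B = n * y ^ 2) :
    ∃ a b u v : ℕ, a * b = n ∧ A = a * u ^ 2 ∧ B = b * v ^ 2 := by
  obtain ⟨A', hA⟩ := Nat.gcd_dvd_right n A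
  obtain ⟨B', hB⟩ := Nat.gcd_dvd_right n B
  -- Coprimality of `A` and `B` makes `n` split as the product of its gcds with them; the cofactors
  -- are coprime with product `y ^ 2`, hence squares.
  have hg : n.gcd A * n.gcd B = n := by
    rw [← h.gcd_mul, hAB, Nat.gcd_mul_right_right]
  have hcop : A'.Coprime B' :=
    (h.coprime_dvd_left ⟨_, hA.trans (mul_comm _ _)⟩).coprime_dvd_right ⟨_, hB.trans (mul_comm _ _)⟩
  have hmul : A' * B' = y ^ 2 := by
    refine Nat.eq_of_mul_eq_mul_left hn ?_
    calc n * (A' * B') = (n.gcd A * A') * (n.gcd B * B') := by rw [mul_mul_mul_comm, hg]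
      _ = n * y ^ 2 := by rw [← hA, ← hB, hAB]
  obtain ⟨u, hu⟩ := exists_eq_pow_of_mul_eq_pow (Nat.isUnit_iff.mpr hcop) hmul
  obtain ⟨v, hv⟩ := exists_eq_pow_of_mul_eq_pow (Nat.isUnit_iff.mpr hcop.symm)
    ((mul_comm _ _).trans hmul)
  exact ⟨_, _, u, v, hg, by rw [← hu]; exact hA, by rw [← hv]; exact hB⟩

/-- Descent on the fundamental solution of Pell's equation `x ^ 2 - n * y ^ 2 = 1`. -/
theorem exists_pell_descent {n q : ℕ} (hn : ¬ IsSquare n) (hodd : Odd n) (hq : q.Prime) (hq4 : q % 4 = 3)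
    (hqn : q ∣ n) :
    ∃ (x y : ℤ) (a b e u v w : ℕ), x ^ 2 - n * y ^ 2 = 1 ∧ a * b = n ∧ (e = 1 ∨ e = 2) ∧
      (e = 1 → a ≠ 1 ∧ b ≠ 1) ∧ (a : ℤ) * u ^ 2 - b * v ^ 2 = e ∧
      2 * (x + 1) = a * e * w ^ 2 ∧ w ≠ 0 ∧ (n % 4 = 1 → e = 1) := by
  have hn0 : 0 < n := Nat.pos_of_ne_zero (by rintro rfl; exact hn (IsSquare.zero))
  obtain ⟨z, hz⟩ := Pell.IsFundamental.exists_of_not_isSquare (d := n) (by exact_mod_cast hn0)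
    (by rwa [Int.isSquare_natCast_iff])
  obtain ⟨hx1, hy0, hmin⟩ := hz
  have hprop := z.prop
  obtain ⟨x, hx⟩ := Int.eq_ofNat_of_zero_le (show 0 ≤ z.x by lia)
  obtain ⟨y, hy⟩ := Int.eq_ofNat_of_zero_le hy0.le
  have hx1' : 1 < x := by lia
  have key : ∃ (a b e u v w : ℕ), a * b = n ∧ (e = 1 ∨ e = 2) ∧
      (e = 1 → x + 1 = 2 * (a * u ^ 2)) ∧ a * u ^ 2 = b * v ^ 2 + e ∧
      2 * (x + 1) = a * e * w ^ 2 ∧ (n % 4 = 1 → e = 1) := by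
    have hnat : (x - 1) * (x + 1) = n * y ^ 2 := by
      zify [hx1'.le]
      rw [hx, hy] at hprop
      linear_combination hprop
    rcases Nat.even_or_odd' x with ⟨k, rfl | rfl⟩
    · have hcop : (2 * k + 1).Coprime (2 * k - 1) := by
        have h2 : 2 * k + 1 = (2 * k - 1) + 2 := by lia
        rw [h2, Nat.coprime_self_add_left, Nat.coprime_comm, Nat.coprime_two_right]
        exact ⟨k - 1, by lia⟩
      obtain ⟨a, b, u, v, hab, hA, hB⟩ := exists_mul_sq_of_coprime_mul_eq hn0 hcop
        ((mul_comm _ _).trans hnat)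
      refine ⟨a, b, 2, u, v, u, hab, Or.inr rfl, by simp, by lia, by rw [hA]; ring, fun h4 => ?_⟩
      -- For even `x` and `n ≡ 1` modulo 4, Pell's equation would make -1 a square modulo 4.
      exfalso
      rw [hx, hy] at hprop
      have hmod : ((2 * k : ℕ) : ZMod 4) ^ 2 - n * y ^ 2 = 1 := by
        exact_mod_cast congrArg (Int.cast : ℤ → ZMod 4) hprop
      have hn4 : (n : ZMod 4) = 1 := by
        rw [← Nat.cast_one, ZMod.natCast_eq_natCast_iff]; exact h4
      rw [hn4] at hmod
      push_cast at hmod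
      generalize (k : ZMod 4) = k' at hmod
      generalize (y : ZMod 4) = y' at hmod
      revert k' y'
      decide
    · have hyev : Even y := by
        have h : Even (n * y ^ 2) := by
          rw [← hnat]
          exact ⟨k * (2 * k + 1 + 1), by rw [Nat.add_sub_cancel]; ring⟩
        rcases Nat.even_mul.mp h with h | h
        · exact absurd hodd (Nat.not_odd_iff_even.mpr h)
        · exact (Nat.even_pow.mp h).1
      obtain ⟨j, rfl⟩ := hyev
      -- For odd `x` a factor 4 cancels, leaving consecutive coprime integers; this is the source of
      -- `e = 1`.
      have hkj : (k + 1) * k = n * j ^ 2 := by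
        rw [Nat.add_sub_cancel] at hnat
        nlinarith only [hnat]
      obtain ⟨a, b, u, v, hab, hA, hB⟩ := exists_mul_sq_of_coprime_mul_eq hn0
        (by simp) hkj
      exact ⟨a, b, 1, u, v, 2 * u, hab, Or.inl rfl, fun _ => by lia, by lia,
        by linear_combination 4 * hA, fun _ => rfl⟩
  obtain ⟨a, b, e, u, v, w, hab, he, he1, heq, hw, h4⟩ := key
  have heqZ : (a : ℤ) * u ^ 2 - b * v ^ 2 = e := by
    have : (a : ℤ) * u ^ 2 = b * v ^ 2 + e := by exact_mod_cast heq
    linear_combination this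
  refine ⟨x, y, a, b, e, u, v, w, by rw [← hx, ← hy]; exact hprop, hab, he, ?_, heqZ,
    by exact_mod_cast hw, by rintro rfl; lia, h4⟩
  rintro rfl
  have hxu := he1 rfl
  constructor
  -- With `a = 1` the pair `(u, v)` would solve Pell's equation with `1 < u < x`, against
  -- minimality.
  · rintro rfl
    rw [one_mul] at hab
    subst hab
    have hu : 1 < u := by nlinarith only [hxu, hx1']
    have hle := hmin (b := Pell.Solution₁.mk u v (by simpa using heqZ))
      (by rw [Pell.Solution₁.x_mk]; exact_mod_cast hu)
    rw [Pell.Solution₁.x_mk, hx] at hle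
    have hle' : x ≤ u := by exact_mod_cast hle
    nlinarith only [hle', hxu, hu]
  -- With `b = 1`, reduction modulo `q` would make -1 a square, impossible for `q ≡ 3` modulo 4.
  · rintro rfl
    rw [mul_one] at hab
    subst hab
    have : Fact q.Prime := ⟨hq⟩
    refine ZMod.mod_four_ne_three_of_sq_eq_neg_one (p := q) (y := (v : ZMod q)) ?_ hq4
    have hmod : (a : ZMod q) * u ^ 2 - v ^ 2 = 1 := by
      simpa using congrArg (Int.cast : ℤ → ZMod q) heqZ
    rw [(ZMod.natCast_eq_zero_iff a q).mpr hqn] at hmod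
    linear_combination -hmod

/-- The number `m` is, up to a unit, a square in the ring `R`. -/
def IsSquareUpToUnit (R : Type*) [CommRing R] (m : ℕ) : Prop :=
  ∃ α : R, Associated (α ^ 2) (m : R)

namespace IsSquareUpToUnit

variable {R : Type*} [CommRing R] {m n : ℕ}

theorem mul (hm : IsSquareUpToUnit R m) (hn : IsSquareUpToUnit R n) :
    IsSquareUpToUnit R (m * n) := by
  obtain ⟨α, hα⟩ := hm
  obtain ⟨β, hβ⟩ := hn
  exact ⟨α * β, by rw [mul_pow, Nat.cast_mul]; exact hα.mul_mul hβ⟩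

/-- Integral closedness lets the square roots themselves be divided: `β ^ 2 ∣ α ^ 2` implies `β ∣
α`. -/
theorem of_mul_left [IsDomain R] [IsIntegrallyClosed R] [CharZero R] (hm0 : m ≠ 0)
    (hmn : IsSquareUpToUnit R (m * n)) (hm : IsSquareUpToUnit R m) : IsSquareUpToUnit R n := by
  obtain ⟨α, hα⟩ := hmn
  obtain ⟨β, hβ⟩ := hm
  obtain ⟨γ, rfl⟩ : β ∣ α := by
    rw [← IsIntegrallyClosed.pow_dvd_pow_iff two_ne_zero]
    exact hβ.dvd.trans ((Dvd.intro _ (by rw [Nat.cast_mul])).trans hα.symm.dvd)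
  rw [mul_pow, Nat.cast_mul] at hα
  exact ⟨γ, hα.of_mul_left hβ fun h => hm0 (by
    rw [h] at hβ
    exact Nat.cast_eq_zero.mp ((associated_zero_iff_eq_zero _).mp hβ.symm))⟩

theorem of_mul_right [IsDomain R] [IsIntegrallyClosed R] [CharZero R] (hn0 : n ≠ 0)
    (hmn : IsSquareUpToUnit R (m * n)) (hn : IsSquareUpToUnit R n) : IsSquareUpToUnit R m :=
  of_mul_left hn0 (mul_comm m n ▸ hmn) hn

theorem of_sq_eq {θ : R} (h : θ ^ 2 = m) : IsSquareUpToUnit R m :=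
  ⟨θ, h ▸ Associated.refl _⟩

theorem sq (m : ℕ) : IsSquareUpToUnit R (m ^ 2) :=
  of_sq_eq (θ := (m : R)) (by simp)

/-- The square class split off from a solution of Pell's equation. -/
theorem of_pell [IsDomain R] [IsIntegrallyClosed R] [CharZero R] {θ : R} (hθ : θ ^ 2 = n)
    {x y : ℤ} (hxy : x ^ 2 - n * y ^ 2 = 1) {w : ℕ} (hw : w ≠ 0)
    (h : 2 * (x + 1) = m * w ^ 2) : IsSquareUpToUnit R m := by
  have hxy' : (x : R) ^ 2 - n * y ^ 2 = 1 := by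
    exact_mod_cast congrArg (Int.cast : ℤ → R) hxy
  have h' : 2 * ((x : R) + 1) = m * w ^ 2 := by
    exact_mod_cast congrArg (Int.cast : ℤ → R) h
  have hunit : IsUnit ((x : R) + y * θ) :=
    IsUnit.of_mul_eq_one ((x : R) - y * θ) (by linear_combination hxy' - y ^ 2 * hθ)
  -- This is the identity `(1 + ε) ^ 2 = 2(x + 1)ε` for the norm-one unit `ε = x + yθ`.
  have hsq : ((x : R) + 1 + y * θ) ^ 2 = (w : R) ^ 2 * (m * (x + y * θ)) := by
    linear_combination (x + y * θ) * h' + y ^ 2 * hθ - hxy'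
  obtain ⟨α, hα⟩ : (w : R) ∣ x + 1 + y * θ := by
    rw [← IsIntegrallyClosed.pow_dvd_pow_iff two_ne_zero]
    exact Dvd.intro _ hsq.symm
  rw [hα, mul_pow] at hsq
  have hα2 := mul_left_cancel₀ (pow_ne_zero 2 (Nat.cast_ne_zero.mpr hw)) hsq
  exact ⟨α, hα2 ▸ associated_mul_unit_left _ _ hunit⟩

end IsSquareUpToUnit

/-- The factors `a` and `b` and the number `e` satisfy `a * u ^ 2 - b * v ^ 2 = ± e` for some
integers `u` and `v`, and `a * e` is up to a unit a square in `R`. -/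
def SplitsAs (R : Type*) [CommRing R] (a b e : ℕ) : Prop :=
  IsSquareUpToUnit R (a * e) ∧
    ∃ u v : ℤ, a * u ^ 2 - b * v ^ 2 = e ∨ a * u ^ 2 - b * v ^ 2 = -e

theorem exists_splitsAs {R : Type*} [CommRing R] [IsDomain R] [IsIntegrallyClosed R] [CharZero R]
    {n q : ℕ} {θ : R} (hθ : θ ^ 2 = n) (hn : ¬ IsSquare n) (hodd : Odd n) (hq : q.Prime)
    (hq4 : q % 4 = 3) (hqn : q ∣ n) :
    ∃ a b e : ℕ, a * b = n ∧ (e = 1 ∨ e = 2) ∧ (e = 1 → a ≠ 1 ∧ b ≠ 1) ∧ (n % 4 = 1 → e = 1) ∧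
      SplitsAs R a b e := by
  obtain ⟨x, y, a, b, e, u, v, w, hxy, hab, he, he1, heq, hw, hw0, h4⟩ :=
    exists_pell_descent hn hodd hq hq4 hqn
  exact ⟨a, b, e, hab, he, he1, h4, .of_pell hθ hxy hw0 (by exact_mod_cast hw),
    u, v, Or.inl heq⟩

namespace SplitsAs

variable {R : Type*} [CommRing R] {a b e : ℕ}

/-- The product of `a * e` and `b * e` is `a * b * e ^ 2`, so their classes agree; the swap reverses
the sign, which is why `SplitsAs` allows both signs. -/
theorem symm [IsDomain R] [IsIntegrallyClosed R] [CharZero R] (ha : a ≠ 0) (he : e ≠ 0)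
    (hab : IsSquareUpToUnit R (a * b)) (h : SplitsAs R a b e) : SplitsAs R b a e := by
  obtain ⟨h1, u, v, huv⟩ := h
  refine ⟨?_, v, u, ?_⟩
  · refine IsSquareUpToUnit.of_mul_left (mul_ne_zero ha he) ?_ h1
    rw [show a * e * (b * e) = a * b * e ^ 2 by ring]
    exact hab.mul (.sq e)
  · rcases huv with huv | huv
    · exact Or.inr (by linear_combination -huv)
    · exact Or.inl (by linear_combination -huv)

/-- Modulo `r` the equation becomes `a * u ^ 2 = ± e`, so `a * e = ± (a * u) ^ 2`; the sign is
harmless because -1 is a square modulo `r`. -/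
theorem legendreSym_eq_one {r : ℕ} [Fact r.Prime] (hr : r % 4 = 1) (h : SplitsAs R a b e)
    (hrb : r ∣ b) (hae : ¬ r ∣ a * e) : legendreSym r ((a * e : ℕ) : ℤ) = 1 := by
  obtain ⟨-, u, v, huv⟩ := h
  have hne : (((a * e : ℕ) : ℤ) : ZMod r) ≠ 0 := by
    rwa [Int.cast_natCast, Ne, ZMod.natCast_eq_zero_iff]
  rw [legendreSym.eq_one_iff _ hne]
  have hb : (b : ZMod r) = 0 := (ZMod.natCast_eq_zero_iff b r).mpr hrb
  have hneg : IsSquare (-1 : ZMod r) := ZMod.exists_sq_eq_neg_one_iff.mpr (by lia)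
  push_cast
  rcases huv with huv | huv
  · have h : (a : ZMod r) * u ^ 2 - b * v ^ 2 = e := by
      exact_mod_cast congrArg (Int.cast : ℤ → ZMod r) huv
    rw [hb] at h
    exact ⟨a * u, by linear_combination -a * h⟩
  · have h : (a : ZMod r) * u ^ 2 - b * v ^ 2 = -e := by
      exact_mod_cast congrArg (Int.cast : ℤ → ZMod r) huv
    rw [hb] at h
    rw [show (a : ZMod r) * e = -1 * (a * u) ^ 2 by linear_combination a * h]
    exact hneg.mul (IsSquare.sq _)

end SplitsAs

end Descent

/-! ### Genus conditions on the factorizations given by the units. -/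

section Genus

theorem Nat.Prime.exists_of_mul_eq_mul {π a b m : ℕ} (hπ : π.Prime) (h : a * b = π * m) :
    (∃ c, a = π * c ∧ c * b = m) ∨ ∃ c, b = π * c ∧ a * c = m := by
  rcases hπ.dvd_mul.mp (Dvd.intro m h.symm) with ⟨c, rfl⟩ | ⟨c, rfl⟩
  · exact Or.inl ⟨c, rfl, Nat.eq_of_mul_eq_mul_left hπ.pos (by rw [← h]; ring)⟩
  · exact Or.inr ⟨c, rfl, Nat.eq_of_mul_eq_mul_left hπ.pos (by rw [← h]; ring)⟩

theorem Nat.Prime.not_isSquare_mul {π m : ℕ} (hπ : π.Prime) (hm : ¬ π ∣ m) :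
    ¬ IsSquare (π * m) := by
  rintro ⟨k, hk⟩
  obtain ⟨c, rfl⟩ : π ∣ k := by
    rcases hπ.dvd_mul.mp (Dvd.intro m hk) with h | h <;> exact h
  exact hm ⟨c * c, Nat.eq_of_mul_eq_mul_left hπ.pos (by rw [hk]; ring)⟩

variable {R : Type*} [CommRing R] [IsDomain R] [IsIntegrallyClosed R] [CharZero R]

/-- The prime two is up to a unit a square as soon as the square root of a prime congruent to three
modulo four is adjoined. -/
theorem isSquareUpToUnit_two {p : ℕ} (hp : p.Prime) (hp4 : p % 4 = 3) {θ : R} (hθ : θ ^ 2 = p) :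
    IsSquareUpToUnit R 2 := by
  obtain ⟨a, b, e, hab, he, he1, -, h, -⟩ := exists_splitsAs hθ
    (by simpa using hp.not_isSquare_mul hp.not_dvd_one) (Nat.odd_iff.mpr (by lia)) hp hp4 dvd_rfl
  -- A prime has only trivial factorizations, and these are excluded for `e = 1`.
  have he2 : e = 2 := by
    refine he.resolve_left fun h1 => ?_
    rcases (Nat.dvd_prime hp).mp (Dvd.intro b hab) with ha | ha
    · exact (he1 h1).1 ha
    · exact (he1 h1).2 (Nat.eq_of_mul_eq_mul_left hp.pos (by rw [← ha, hab]; simp [ha]))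
  subst he2
  rcases (Nat.dvd_prime hp).mp (Dvd.intro b hab) with ha | ha
  · simpa [ha] using h
  · exact .of_mul_left hp.ne_zero (ha ▸ h) (.of_sq_eq hθ)

/-- The relation between the classes of the primes above `q`, `r` and `s` that comes from the
fundamental unit of `ℚ(√(q * r * s))`. -/
theorem splitting_of_three_primes {q r s : ℕ} [Fact q.Prime] [Fact r.Prime] [Fact s.Prime]
    (hq : q % 4 = 3) (hr : r % 4 = 1) (hs : s % 4 = 1) (hrs : r ≠ s) (h2 : legendreSym s 2 = -1)
    {θ : R} (hθ : θ ^ 2 = (q * r * s : ℕ)) (hR2 : IsSquareUpToUnit R 2) :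
    ∃ e : ℕ, (e = 1 ∨ e = 2) ∧
      (IsSquareUpToUnit R q ∧ legendreSym s (q * e) = 1 ∧ legendreSym r (q * e) = 1 ∨
       IsSquareUpToUnit R r ∧ legendreSym s (r * e) = 1 ∧ legendreSym r (q * s * e) = 1 ∨
       IsSquareUpToUnit R s ∧ legendreSym s (q * r * e) = 1 ∧ legendreSym r (s * e) = 1) := by
  have hqP : q.Prime := Fact.out
  have hrP : r.Prime := Fact.out
  have hsP : s.Prime := Fact.out
  have hrq : r ≠ q := by rintro rfl; lia
  have hsq : s ≠ q := by rintro rfl; lia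
  have hr2 : r ≠ 2 := by rintro rfl; lia
  have hs2 : s ≠ 2 := by rintro rfl; lia
  have hodd : (q * r * s) % 4 = 3 := by simp [Nat.mul_mod, hq, hr, hs]
  have hn : ¬ IsSquare (q * r * s) := by
    rw [mul_assoc]
    refine hqP.not_isSquare_mul ?_
    rw [hqP.dvd_mul, Nat.prime_dvd_prime_iff_eq hqP hrP, Nat.prime_dvd_prime_iff_eq hqP hsP]
    tauto
  obtain ⟨a, b, e, hab, he, he1, -, h⟩ := exists_splitsAs hθ hn
    (Nat.odd_iff.mpr (by lia)) hqP hq ⟨r * s, by ring⟩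
  have he0 : e ≠ 0 := by lia
  have hRe : IsSquareUpToUnit R e := by
    rcases he with rfl | rfl
    · simpa using IsSquareUpToUnit.sq (R := R) 1
    · exact hR2
  have hRn : IsSquareUpToUnit R (q * r * s) := .of_sq_eq hθ
  have hre : ¬ r ∣ e := by
    rcases he with rfl | rfl
    · exact hrP.not_dvd_one
    · rwa [Nat.prime_dvd_prime_iff_eq hrP Nat.prime_two]
  have hse : ¬ s ∣ e := by
    rcases he with rfl | rfl
    · exact hsP.not_dvd_one
    · rwa [Nat.prime_dvd_prime_iff_eq hsP Nat.prime_two]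
  refine ⟨e, he, ?_⟩
  -- The symmetry `SplitsAs.symm` places `s` in `b`, so that reduction modulo `s` applies directly;
  -- four choices for `a` remain.
  wlog hsb : s ∣ b generalizing a b
  · have hab0 : a * b ≠ 0 := by rw [hab]; lia
    refine this b a (by rw [mul_comm, hab]) (fun h => (he1 h).symm)
      (h.symm (left_ne_zero_of_mul hab0) he0 (hab ▸ hRn)) ?_
    exact (hsP.dvd_mul.mp (hab ▸ Dvd.intro_left _ rfl)).resolve_right hsb
  obtain ⟨c, rfl⟩ := hsb
  have hac : a * c = q * (r * 1) :=
    Nat.eq_of_mul_eq_mul_left hsP.pos (by linear_combination hab)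
  -- The swapped relation is what can be read modulo `r` when `r` divides `a`.
  have hH : SplitsAs R (s * c) a e := by
    have hab0 : a * (s * c) ≠ 0 := by rw [hab]; lia
    exact h.symm (left_ne_zero_of_mul hab0) he0 (hab ▸ hRn)
  rcases hqP.exists_of_mul_eq_mul hac with ⟨a, rfl, hac₁⟩ | ⟨c, rfl, hac₁⟩ <;>
  rcases hrP.exists_of_mul_eq_mul hac₁ with ⟨a, rfl, hac'⟩ | ⟨c, rfl, hac'⟩ <;>
  obtain ⟨rfl, rfl⟩ := mul_eq_one.mp hac'
  · refine Or.inr (Or.inr ⟨?_, ?_, ?_⟩)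
    · refine .of_mul_left (m := q * r) (mul_ne_zero hqP.ne_zero hrP.ne_zero) hRn ?_
      simpa using h.1.of_mul_right he0 hRe
    · simpa [mul_assoc] using h.legendreSym_eq_one hs ⟨1, rfl⟩
        (by simp [hsP.dvd_mul, Nat.prime_dvd_prime_iff_eq, *, Ne.symm hrs])
    · simpa [mul_assoc] using hH.legendreSym_eq_one hr ⟨q, by ring⟩
        (by simp [hrP.dvd_mul, Nat.prime_dvd_prime_iff_eq, *])
  · refine Or.inl ⟨?_, ?_, ?_⟩
    · simpa using h.1.of_mul_right he0 hRe
    · simpa [mul_assoc] using h.legendreSym_eq_one hs ⟨r * 1, rfl⟩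
        (by simp [hsP.dvd_mul, Nat.prime_dvd_prime_iff_eq, *])
    · simpa [mul_assoc] using h.legendreSym_eq_one hr ⟨s, by ring⟩
        (by simp [hrP.dvd_mul, Nat.prime_dvd_prime_iff_eq, *])
  · refine Or.inr (Or.inl ⟨?_, ?_, ?_⟩)
    · simpa using h.1.of_mul_right he0 hRe
    · simpa [mul_assoc] using h.legendreSym_eq_one hs ⟨q * 1, rfl⟩
        (by simp [hsP.dvd_mul, Nat.prime_dvd_prime_iff_eq, *, Ne.symm hrs])
    · simpa [mul_assoc, mul_comm, mul_left_comm] using hH.legendreSym_eq_one hr ⟨1, rfl⟩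
        (by simp [hrP.dvd_mul, Nat.prime_dvd_prime_iff_eq, *])
  -- Here `a = 1`, which forces `e = 2` and makes 2 a square modulo `s`.
  · exfalso
    have he2 : e = 2 := he.resolve_left fun h => (he1 h).1 rfl
    subst he2
    have := h.legendreSym_eq_one hs ⟨q * (r * 1), rfl⟩ (by simpa using hse)
    rw [one_mul, Nat.cast_two, h2] at this
    exact absurd this (by decide)

/-- The relation between the classes of the primes above `q`, `r` and `s` that comes from the
fundamental unit of `ℚ(√(p * q * r * s))`, given that the prime above `p` is principal. -/
theorem splitting_of_four_primes {p q r s : ℕ} [Fact p.Prime] [Fact q.Prime] [Fact r.Prime]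
    [Fact s.Prime] (hp : p % 4 = 3) (hq : q % 4 = 3) (hr : r % 4 = 1) (hs : s % 4 = 1)
    (hpq : p ≠ q) (hrs : r ≠ s) {θ : R} (hθ : θ ^ 2 = (p * q * r * s : ℕ))
    (hRp : IsSquareUpToUnit R p) (hRn : IsSquareUpToUnit R (q * r * s)) :
    legendreSym s p = 1 ∧ legendreSym r p = 1 ∨
    IsSquareUpToUnit R q ∧ legendreSym s q = 1 ∧ legendreSym r q = 1 ∨
    IsSquareUpToUnit R q ∧ legendreSym s (p * q) = 1 ∧ legendreSym r (p * q) = 1 ∨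
    IsSquareUpToUnit R r ∧ legendreSym s r = 1 ∧ legendreSym r (p * q * s) = 1 ∨
    IsSquareUpToUnit R r ∧ legendreSym s (p * r) = 1 ∧ legendreSym r (q * s) = 1 ∨
    IsSquareUpToUnit R s ∧ legendreSym s (q * r) = 1 ∧ legendreSym r (p * s) = 1 ∨
    IsSquareUpToUnit R s ∧ legendreSym s (p * q * r) = 1 ∧ legendreSym r s = 1 := by
  have hpP : p.Prime := Fact.out
  have hqP : q.Prime := Fact.out
  have hrP : r.Prime := Fact.out
  have hsP : s.Prime := Fact.out
  have hrq : r ≠ q := by rintro rfl; lia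
  have hsq : s ≠ q := by rintro rfl; lia
  have hrp : r ≠ p := by rintro rfl; lia
  have hsp : s ≠ p := by rintro rfl; lia
  have hn4 : (p * q * r * s) % 4 = 1 := by simp [Nat.mul_mod, hp, hq, hr, hs]
  have hn : ¬ IsSquare (p * q * r * s) := by
    rw [mul_assoc, mul_assoc]
    refine hpP.not_isSquare_mul ?_
    rw [hpP.dvd_mul, hpP.dvd_mul, Nat.prime_dvd_prime_iff_eq hpP hqP,
      Nat.prime_dvd_prime_iff_eq hpP hrP, Nat.prime_dvd_prime_iff_eq hpP hsP]
    tauto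
  obtain ⟨a, b, e, hab, -, he1, h4, h⟩ := exists_splitsAs hθ hn
    (Nat.odd_iff.mpr (by lia)) hpP hp ⟨q * r * s, by ring⟩
  -- Since `n ≡ 1` modulo 4, the factor 2 does not occur.
  obtain rfl := h4 hn4
  replace he1 := he1 rfl
  have hRn' : IsSquareUpToUnit R (p * q * r * s) := .of_sq_eq hθ
  wlog hsb : s ∣ b generalizing a b
  · have hab0 : a * b ≠ 0 := by rw [hab]; lia
    refine this b a (by rw [mul_comm, hab])
      (h.symm (left_ne_zero_of_mul hab0) one_ne_zero (hab ▸ hRn')) he1.symm ?_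
    exact (hsP.dvd_mul.mp (hab ▸ Dvd.intro_left _ rfl)).resolve_right hsb
  obtain ⟨c, rfl⟩ := hsb
  have hac : a * c = p * (q * (r * 1)) :=
    Nat.eq_of_mul_eq_mul_left hsP.pos (by linear_combination hab)
  have hH : SplitsAs R (s * c) a 1 := by
    have hab0 : a * (s * c) ≠ 0 := by rw [hab]; lia
    exact h.symm (left_ne_zero_of_mul hab0) one_ne_zero (hab ▸ hRn')
  rcases hpP.exists_of_mul_eq_mul hac with ⟨a, rfl, hac₁⟩ | ⟨c, rfl, hac₁⟩ <;>
  rcases hqP.exists_of_mul_eq_mul hac₁ with ⟨a, rfl, hac₂⟩ | ⟨c, rfl, hac₂⟩ <;>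
  rcases hrP.exists_of_mul_eq_mul hac₂ with ⟨a, rfl, hac₃⟩ | ⟨c, rfl, hac₃⟩ <;>
  obtain ⟨rfl, rfl⟩ := mul_eq_one.mp hac₃ <;>
  have hS := h.legendreSym_eq_one hs (Dvd.intro _ rfl)
    (by simp [hsP.dvd_mul, Nat.prime_dvd_prime_iff_eq, *, Ne.symm hrs, hsP.ne_one])
  · have hR := hH.legendreSym_eq_one hr ⟨p * q, by ring⟩
      (by simp [Nat.prime_dvd_prime_iff_eq, *])
    have hqr : IsSquareUpToUnit R (q * r) :=
      .of_mul_left hpP.ne_zero (by simpa using h.1) hRp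
    have hRs : IsSquareUpToUnit R s :=
      .of_mul_left (mul_ne_zero hqP.ne_zero hrP.ne_zero) hRn hqr
    simp_all [mul_assoc]
  · have hR := h.legendreSym_eq_one hr ⟨s, by ring⟩
      (by simp [hrP.dvd_mul, Nat.prime_dvd_prime_iff_eq, *])
    have hRq : IsSquareUpToUnit R q :=
      .of_mul_left hpP.ne_zero (by simpa using h.1) hRp
    simp_all [mul_assoc]
  · have hR := hH.legendreSym_eq_one hr ⟨p, by ring⟩
      (by simp [hrP.dvd_mul, Nat.prime_dvd_prime_iff_eq, *])
    have hRr : IsSquareUpToUnit R r :=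
      .of_mul_left hpP.ne_zero (by simpa using h.1) hRp
    simp_all [mul_comm]
  -- The factor `a = p` gives no new class, only the symbols of `p`; this is the first alternative.
  · have hR := h.legendreSym_eq_one hr ⟨s * q, by ring⟩
      (by simp [Nat.prime_dvd_prime_iff_eq, *])
    simp_all
  · have hR := hH.legendreSym_eq_one hr ⟨q, by ring⟩
      (by simp [hrP.dvd_mul, Nat.prime_dvd_prime_iff_eq, *])
    have hqr : IsSquareUpToUnit R (q * r) := by simpa using h.1
    have hRs : IsSquareUpToUnit R s :=
      .of_mul_left (mul_ne_zero hqP.ne_zero hrP.ne_zero) hRn hqr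
    simp_all [mul_comm]
  · have hR := h.legendreSym_eq_one hr ⟨s * p, by ring⟩
      (by simp [Nat.prime_dvd_prime_iff_eq, *])
    have hRq : IsSquareUpToUnit R q := by simpa using h.1
    simp_all
  · have hR := hH.legendreSym_eq_one hr ⟨1, by ring⟩
      (by simp [hrP.dvd_mul, Nat.prime_dvd_prime_iff_eq, *])
    have hRr : IsSquareUpToUnit R r := by simpa using h.1
    exact Or.inr (Or.inr (Or.inr (Or.inl ⟨hRr, by simpa using hS,
      by simpa [mul_comm, mul_left_comm, mul_assoc] using hR⟩)))
  · exact absurd rfl he1.1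

end Genus

/-! ### Galois action and inertia in the biquadratic field. -/

section Biquadratic

theorem adjoinSqrts_exists_sq (a b : ℕ) :
    ∃ A B : 𝓞 (adjoinSqrts a b), A ^ 2 = a ∧ B ^ 2 = b ∧
      ((A : adjoinSqrts a b) : ℝ) = √(a : ℝ) ∧ ((B : adjoinSqrts a b) : ℝ) = √(b : ℝ) := by
  have key : ∀ n : ℕ, √(n : ℝ) ∈ adjoinSqrts a b →
      ∃ A : 𝓞 (adjoinSqrts a b), A ^ 2 = n ∧ ((A : adjoinSqrts a b) : ℝ) = √(n : ℝ) := by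
    intro n hn
    have hsq : (⟨_, hn⟩ : adjoinSqrts a b) ^ 2 = n :=
      Subtype.ext (by simp [Real.sq_sqrt n.cast_nonneg])
    have hint : IsIntegral ℤ (⟨_, hn⟩ : adjoinSqrts a b) :=
      .of_pow two_pos (by rw [hsq]; exact isIntegral_algebraMap (R := ℤ) (x := (n : ℤ)))
    obtain ⟨A, hA⟩ := (IsIntegralClosure.isIntegral_iff (A := 𝓞 (adjoinSqrts a b))).mp hint
    refine ⟨A, FaithfulSMul.algebraMap_injective _ (adjoinSqrts a b) ?_, congrArg Subtype.val hA⟩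
    rw [map_pow, map_natCast, hA, hsq]
  obtain ⟨A, hA, hA'⟩ := key a (IntermediateField.subset_adjoin _ _ (by simp))
  obtain ⟨B, hB, hB'⟩ := key b (IntermediateField.subset_adjoin _ _ (by simp))
  exact ⟨A, B, hA, hB, hA', hB'⟩

instance adjoinSqrts_isGalois (a b : ℕ) : IsGalois ℚ (adjoinSqrts a b) := by
  obtain ⟨A, B, hA, hB, hA', hB'⟩ := adjoinSqrts_exists_sq a b
  have key : ∀ (n : ℕ) (z : adjoinSqrts a b), z ^ 2 = n → (z : ℝ) = √(n : ℝ) →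
      ((minpoly ℚ √(n : ℝ)).map (algebraMap ℚ (adjoinSqrts a b))).Splits := by
    intro n z hz hz'
    have hdvd : minpoly ℚ √(n : ℝ) ∣ Polynomial.X ^ 2 - Polynomial.C (n : ℚ) :=
      minpoly.dvd _ _ (by simp [Real.sq_sqrt n.cast_nonneg])
    have hfac : (Polynomial.X ^ 2 - Polynomial.C (n : ℚ)).map (algebraMap ℚ (adjoinSqrts a b)) =
        (Polynomial.X - Polynomial.C z) * (Polynomial.X + Polynomial.C z) := by
      rw [Polynomial.map_sub, Polynomial.map_pow, Polynomial.map_X, Polynomial.map_C, map_natCast,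
        ← hz, Polynomial.C_pow]
      ring
    refine Polynomial.Splits.of_dvd ?_ ?_ (Polynomial.map_dvd _ hdvd)
    · rw [hfac]
      exact (Polynomial.Splits.X_sub_C z).mul (Polynomial.Splits.X_add_C z)
    · rw [← Polynomial.map_zero (algebraMap ℚ (adjoinSqrts a b)), Ne,
        (Polynomial.map_injective _ (algebraMap ℚ (adjoinSqrts a b)).injective).eq_iff]
      exact Polynomial.X_pow_sub_C_ne_zero two_pos _
  have hn : Normal ℚ (adjoinSqrts a b) := normal_iff.mpr fun x => by
    refine ⟨Algebra.IsIntegral.isIntegral x, ?_⟩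
    rw [← minpoly.algebraMap_eq (algebraMap (adjoinSqrts a b) ℝ).injective x]
    refine IntermediateField.splits_of_mem_adjoin (F := ℚ) (S := {√(a : ℝ), √(b : ℝ)})
      (splits := fun y hy => ?_) (hx := x.2)
    rcases hy with rfl | rfl
    · exact ⟨isIntegral_sqrt_natCast a, key a A (by exact_mod_cast congrArg (algebraMap _ _) hA) hA'⟩
    · exact ⟨isIntegral_sqrt_natCast b, key b B (by exact_mod_cast congrArg (algebraMap _ _) hB) hB'⟩
  exact IsGalois.mk

theorem adjoinSqrts_aut_eq_one {a b : ℕ} {A B : 𝓞 (adjoinSqrts a b)}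
    (hA : ((A : adjoinSqrts a b) : ℝ) = √(a : ℝ)) (hB : ((B : adjoinSqrts a b) : ℝ) = √(b : ℝ))
    {σ : Gal(adjoinSqrts a b/ℚ)} (hσA : σ • A = A) (hσB : σ • B = B) : σ = 1 := by
  have key : ∀ (C : 𝓞 (adjoinSqrts a b)) (x : ℝ) (hx : x ∈ adjoinSqrts a b),
      ((C : adjoinSqrts a b) : ℝ) = x → σ • C = C → σ ⟨x, hx⟩ = ⟨x, hx⟩ := by
    rintro C x hx rfl h
    exact congrArg (fun z : 𝓞 (adjoinSqrts a b) => (z : adjoinSqrts a b)) h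
  have h : (σ : adjoinSqrts a b →ₐ[ℚ] adjoinSqrts a b) = AlgHom.id ℚ _ := by
    refine IntermediateField.algHom_ext_of_eq_adjoin ℚ (rfl : adjoinSqrts a b = _) fun x hx => ?_
    rcases hx with rfl | rfl
    · exact key A _ _ hA hσA
    · exact key B _ _ hB hσB
  exact AlgEquiv.ext fun x => DFunLike.congr_fun h x

section Inertia

variable {K : Type*} [Field K] [NumberField K]

theorem smul_eq_or_eq_neg_of_sq {x : 𝓞 K} {m : ℕ} (hx : x ^ 2 = m) (σ : Gal(K/ℚ)) :
    σ • x = x ∨ σ • x = -x := by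
  rw [← sq_eq_sq_iff_eq_or_eq_neg, ← smul_pow', hx]
  exact map_natCast (MulSemiringAction.toRingHom Gal(K/ℚ) (𝓞 K) σ) m

/-- The rational prime in a prime ideal divides every natural number in that ideal. -/
theorem dvd_of_mem_of_mem {P : Ideal (𝓞 K)} (hP : P.IsPrime) {ℓ m : ℕ} (hℓ : ℓ.Prime)
    (hℓP : (ℓ : 𝓞 K) ∈ P) (hm : (m : 𝓞 K) ∈ P) : ℓ ∣ m := by
  by_contra h
  obtain ⟨u, v, huv⟩ := Nat.isCoprime_iff_coprime.mpr ((hℓ.coprime_iff_not_dvd).mpr h)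
  refine hP.ne_top ((Ideal.eq_top_iff_one P).mpr ?_)
  have h1 : (u : 𝓞 K) * ℓ + v * m = 1 := by
    exact_mod_cast congrArg (Int.cast : ℤ → 𝓞 K) huv
  rw [← h1]
  exact P.add_mem (P.mul_mem_left _ hℓP) (P.mul_mem_left _ hm)

/-- If `σ` sent `x` to `-x`, then `P` would contain `2x`, hence `4m`, which is prime to `ℓ`. -/
theorem smul_eq_of_mem_inertia {P : Ideal (𝓞 K)} (hP : P.IsPrime) {ℓ m : ℕ} (hℓ : ℓ.Prime)
    (hℓP : (ℓ : 𝓞 K) ∈ P) (hℓ2 : ℓ ≠ 2) (hm : ¬ ℓ ∣ m) {x : 𝓞 K} (hx : x ^ 2 = m)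
    {σ : Gal(K/ℚ)} (hσ : σ ∈ P.inertia Gal(K/ℚ)) : σ • x = x := by
  refine (smul_eq_or_eq_neg_of_sq hx σ).resolve_right fun h => ?_
  have hmem : σ • x - x ∈ P := hσ x
  have h4 : ((4 * m : ℕ) : 𝓞 K) ∈ P := by
    rw [show ((4 * m : ℕ) : 𝓞 K) = (-2 * x) * (σ • x - x) by
      push_cast; rw [h, ← hx]; ring]
    exact P.mul_mem_left _ hmem
  rcases hℓ.dvd_mul.mp (dvd_of_mem_of_mem hP hℓ hℓP h4) with h' | h'
  · exact hℓ2 ((Nat.prime_dvd_prime_iff_eq hℓ Nat.prime_two).mp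
      (hℓ.dvd_of_dvd_pow (n := 2) h'))
  · exact hm h'

/-- As `m ≡ 1` modulo 4, `w = (1 + x) / 2` is integral. If `σ` negated `x`, then `σ • w - w = -x`
would lie in `P`, and so would the odd number `m`. -/
theorem smul_eq_of_mem_inertia_two {P : Ideal (𝓞 K)} (hP : P.IsPrime)
    (h2P : ((2 : ℕ) : 𝓞 K) ∈ P) {m : ℕ} (hm : m % 4 = 1) {x : 𝓞 K} (hx : x ^ 2 = m)
    {σ : Gal(K/ℚ)} (hσ : σ ∈ P.inertia Gal(K/ℚ)) : σ • x = x := by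
  refine (smul_eq_or_eq_neg_of_sq hx σ).resolve_right fun h => ?_
  obtain ⟨k, hk⟩ : ∃ k, m = 4 * k + 1 := ⟨m / 4, by lia⟩
  obtain ⟨w, hw⟩ : (2 : 𝓞 K) ∣ 1 + x := by
    have hsq : (x : K) ^ 2 = 4 * k + 1 := by
      have := congrArg (algebraMap (𝓞 K) K) hx
      rw [map_pow, map_natCast, hk] at this
      exact_mod_cast this
    have hint : IsIntegral ℤ ((1 + (x : K)) / 2) := by
      refine ⟨Polynomial.X ^ 2 - Polynomial.X - Polynomial.C (k : ℤ), by monicity!, ?_⟩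
      simp only [Polynomial.eval₂_sub, Polynomial.eval₂_pow, Polynomial.eval₂_X,
        Polynomial.eval₂_C]
      rw [map_natCast]
      linear_combination hsq / 4
    refine ⟨⟨_, hint⟩, ?_⟩
    ext1
    change 1 + (x : K) = 2 * ((1 + (x : K)) / 2)
    ring
  have hmem : σ • w - w ∈ P := hσ w
  have hval : σ • w - w = -x := by
    refine mul_left_cancel₀ (two_ne_zero (α := 𝓞 K)) ?_
    have h1 := congrArg (MulSemiringAction.toRingHom Gal(K/ℚ) (𝓞 K) σ) hw
    rw [map_add, map_mul, map_one, map_ofNat] at h1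
    simp only [MulSemiringAction.toRingHom_apply, h] at h1
    linear_combination -h1 + hw
  have hmP : (m : 𝓞 K) ∈ P := by
    rw [← hx, show x ^ 2 = -x * (σ • w - w) by rw [hval]; ring]
    exact P.mul_mem_left _ hmem
  have := dvd_of_mem_of_mem hP Nat.prime_two h2P hmP
  lia

/-- An element of the inertia group is determined by the sign with which it acts on `y`. -/
theorem card_inertia_le_two {P : Ideal (𝓞 K)} {y : 𝓞 K} {m : ℕ} (hy : y ^ 2 = m)
    (h : ∀ σ ∈ P.inertia Gal(K/ℚ), σ • y = y → σ = 1) :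
    Nat.card (P.inertia Gal(K/ℚ)) ≤ 2 := by
  classical
  rw [← Nat.card_eq_two_iff.mpr ⟨true, false, by simp, by ext b; cases b <;> simp⟩]
  refine Nat.card_le_card_of_injective
    (fun σ : P.inertia Gal(K/ℚ) => decide ((σ : Gal(K/ℚ)) • y = y)) fun σ τ hστ => ?_
  rw [decide_eq_decide] at hστ
  have heq : (σ : Gal(K/ℚ)) • y = (τ : Gal(K/ℚ)) • y := by
    by_cases hσ : (σ : Gal(K/ℚ)) • y = y
    · rw [hσ, hστ.mp hσ]
    · rw [(smul_eq_or_eq_neg_of_sq hy σ.1).resolve_left hσ,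
        (smul_eq_or_eq_neg_of_sq hy τ.1).resolve_left fun h => hσ (hστ.mpr h)]
  have h1 := h _ (τ⁻¹ * σ).2 (by
    rw [Subgroup.coe_mul, mul_smul, heq, ← mul_smul, ← Subgroup.coe_mul, inv_mul_cancel,
      Subgroup.coe_one, one_smul])
  exact (inv_mul_eq_one.mp (Subtype.ext h1)).symm

end Inertia

end Biquadratic

/-! ### The Pólya criterion and the combinatorics of the symbols. -/

section Polya

variable {p q r s : ℕ}

/-- The field `ℚ(√p, √(q * r * s))` is a Pólya field as soon as the rational primes `q`, `r` and `s`
are squares of principal ideals. -/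
theorem isPolyaField_adjoinSqrts (hp : p.Prime) (hq : q.Prime) (hr : r.Prime) (hs : s.Prime)
    (hp4 : p % 4 = 3) (hq4 : q % 4 = 3) (hr4 : r % 4 = 1) (hs4 : s % 4 = 1)
    (hHq : IsSquareUpToUnit (𝓞 (adjoinSqrts p (q * r * s))) q)
    (hHr : IsSquareUpToUnit (𝓞 (adjoinSqrts p (q * r * s))) r)
    (hHs : IsSquareUpToUnit (𝓞 (adjoinSqrts p (q * r * s))) s) :
    IsPolyaField (adjoinSqrts p (q * r * s)) := by
  intro ℓ f hℓ _
  obtain ⟨A, B, hA, hB, hA', hB'⟩ := adjoinSqrts_exists_sq p (q * r * s)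
  have hA0 : A ≠ 0 := by
    rintro rfl
    exact hp.ne_zero (by simpa using hA.symm)
  have hpO : (p : 𝓞 (adjoinSqrts p (q * r * s))) ≠ 0 := Nat.cast_ne_zero.mpr hp.ne_zero
  have hAB : (A * B) ^ 2 = (p * (q * r * s) : ℕ) := by
    rw [mul_pow, hA, hB, ← Nat.cast_mul]
  have hrp : r ≠ p := by rintro rfl; lia
  have hsp : s ≠ p := by rintro rfl; lia
  refine isPrincipal_ostrowskiIdeal_of_card_inertia hℓ fun P hP hℓP => ?_
  have hfix : ∀ σ : Gal(adjoinSqrts p (q * r * s)/ℚ), σ • A = A → σ • (A * B) = A * B → σ = 1 := by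
    intro σ h1 h2
    rw [smul_mul', h1] at h2
    exact adjoinSqrts_aut_eq_one hA' hB' h1 (mul_left_cancel₀ hA0 h2)
  rcases eq_or_ne ℓ 2 with rfl | hℓ2
  · refine Or.inr ⟨card_inertia_le_two hA fun σ hσ hσA => hfix σ hσA ?_, ?_⟩
    -- The product `pqrs` is 1 modulo 4, so inertia at 2 fixes `√(pqrs)`.
    · exact smul_eq_of_mem_inertia_two hP hℓP
        (by simp [Nat.mul_mod, hp4, hq4, hr4, hs4]) hAB hσ
    · exact isSquareUpToUnit_two hp hp4 hA
  rcases eq_or_ne ℓ p with rfl | hℓp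
  · refine Or.inr ⟨card_inertia_le_two hA fun σ hσ hσA => hfix σ hσA ?_, A, hA ▸ .refl _⟩
    rcases eq_or_ne ℓ q with rfl | hpq
    -- For `p = q` both generators involve `√p`; dividing `A * B` by `p` gives `√(rs)`, on which
    -- inertia at `p` acts trivially.
    · obtain ⟨C, hC⟩ : (ℓ : 𝓞 (adjoinSqrts ℓ (ℓ * r * s))) ∣ A * B := by
        rw [← IsIntegrallyClosed.pow_dvd_pow_iff two_ne_zero, hAB]
        exact ⟨(r * s : ℕ), by push_cast; ring⟩
      have hC2 : C ^ 2 = (r * s : ℕ) := by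
        refine mul_left_cancel₀ (pow_ne_zero 2 hpO) ?_
        rw [← mul_pow, ← hC, hAB]
        push_cast
        ring
      have hσC := smul_eq_of_mem_inertia hP hℓ hℓP hℓ2
        (by simp [hℓ.dvd_mul, Nat.prime_dvd_prime_iff_eq, *, hrp.symm, hsp.symm]) hC2 hσ
      rw [hC, smul_mul', hσC]
      congr 1
      exact map_natCast (MulSemiringAction.toRingHom Gal(adjoinSqrts ℓ (ℓ * r * s)/ℚ) _ σ) ℓ
    · rw [smul_mul', hσA, smul_eq_of_mem_inertia hP hℓ hℓP hℓ2
        (by simp [hℓ.dvd_mul, Nat.prime_dvd_prime_iff_eq, *, hrp.symm, hsp.symm]) hB hσ]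
  have hσA : ∀ σ ∈ P.inertia Gal(adjoinSqrts p (q * r * s)/ℚ), σ • A = A := fun σ hσ =>
    smul_eq_of_mem_inertia hP hℓ hℓP hℓ2
      (by rwa [Nat.prime_dvd_prime_iff_eq hℓ hp]) hA hσ
  by_cases hdvd : ℓ ∣ q * r * s
  · refine Or.inr ⟨card_inertia_le_two hB fun σ hσ hσB =>
      adjoinSqrts_aut_eq_one hA' hB' (hσA σ hσ) hσB, ?_⟩
    rw [hℓ.dvd_mul, hℓ.dvd_mul, Nat.prime_dvd_prime_iff_eq hℓ hq, Nat.prime_dvd_prime_iff_eq hℓ hr,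
      Nat.prime_dvd_prime_iff_eq hℓ hs] at hdvd
    rcases hdvd with (rfl | rfl) | rfl <;> assumption
  · left
    have hbot : P.inertia Gal(adjoinSqrts p (q * r * s)/ℚ) = ⊥ :=
      (Subgroup.eq_bot_iff_forall _).mpr fun σ hσ => adjoinSqrts_aut_eq_one hA' hB' (hσA σ hσ)
        (smul_eq_of_mem_inertia hP hℓ hℓP hℓ2 hdvd hB hσ)
    rw [hbot]
    simp

/-- The values of the Legendre symbols in which two of the three classes are trivial, if `r` and `s`
are both inert for two. -/
theorem of_symbols_of_both_inert {Hq Hr Hs X : Prop} {rp sp rq sq rs re se : ℤ}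
    (hrp : rp = 1 ∨ rp = -1) (hsp : sp = 1 ∨ sp = -1) (hrq : rq = 1 ∨ rq = -1)
    (hsq : sq = 1 ∨ sq = -1) (hrs : rs = 1 ∨ rs = -1)
    (he : re = 1 ∧ se = 1 ∨ re = -1 ∧ se = -1)
    (hC : (rq = -1 ∧ sq = -1 ∧ rp * sp = -1) ∨ (rq * sq = -1 ∧ rp = -1 ∧ sp = -1))
    (h3 : Hq ∧ sq * se = 1 ∧ rq * re = 1 ∨ Hr ∧ rs * se = 1 ∧ rq * rs * re = 1 ∨
      Hs ∧ sq * rs * se = 1 ∧ rs * re = 1)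
    (h4 : sp = 1 ∧ rp = 1 ∨ Hq ∧ sq = 1 ∧ rq = 1 ∨ Hq ∧ sp * sq = 1 ∧ rp * rq = 1 ∨
      Hr ∧ rs = 1 ∧ rp * rq * rs = 1 ∨ Hr ∧ sp * rs = 1 ∧ rq * rs = 1 ∨
      Hs ∧ sq * rs = 1 ∧ rp * rs = 1 ∨ Hs ∧ sp * sq * rs = 1 ∧ rs = 1)
    (hqr : Hq → Hr → X) (hqs : Hq → Hs → X) (hrs' : Hr → Hs → X) : X := by
  -- In each sign pattern allowed by `hC`, the alternatives left in `h3` and `h4` name different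
  -- primes. Here `re` and `se` are the symbols of `e` at `r` and `s`.
  rcases hrp with rfl | rfl <;> rcases hsp with rfl | rfl <;> rcases hrq with rfl | rfl <;>
  rcases hsq with rfl | rfl <;> rcases hrs with rfl | rfl <;> rcases he with ⟨rfl, rfl⟩ | ⟨rfl, rfl⟩ <;>
  simp at hC h3 h4 <;> tauto

/-- The values of the Legendre symbols in which two of the three classes are trivial, if two is
split for `r` and inert for `s`. -/
theorem of_symbols_of_split_of_inert {Hq Hr Hs X : Prop} {rp sp rq sq rs re se : ℤ} {E : Prop}
    (hrp : rp = 1 ∨ rp = -1) (hsp : sp = 1 ∨ sp = -1) (hrq : rq = 1 ∨ rq = -1)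
    (hsq : sq = 1 ∨ sq = -1) (hrs : rs = 1 ∨ rs = -1)
    (he : re = 1 ∧ se = 1 ∨ re = 1 ∧ se = -1)
    (hC : (rs = -1 ∧ sq = -1 ∧ rp = -1 ∧ rq = 1) ∨ (rq = -1 ∧ rs = -1 ∧ rp = -1 ∧ sp = 1) ∨
      (rq = -1 ∧ rp = -1 ∧ sp * sq = -1 ∧ rs = 1))
    (h3 : Hq ∧ sq * se = 1 ∧ rq * re = 1 ∨ Hr ∧ rs * se = 1 ∧ rq * rs * re = 1 ∨
      Hs ∧ sq * rs * se = 1 ∧ rs * re = 1)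
    (h4 : ¬ E → (sp = 1 ∧ rp = 1 ∨ Hq ∧ sq = 1 ∧ rq = 1 ∨ Hq ∧ sp * sq = 1 ∧ rp * rq = 1 ∨
      Hr ∧ rs = 1 ∧ rp * rq * rs = 1 ∨ Hr ∧ sp * rs = 1 ∧ rq * rs = 1 ∨
      Hs ∧ sq * rs = 1 ∧ rp * rs = 1 ∨ Hs ∧ sp * sq * rs = 1 ∧ rs = 1))
    (hE : E → Hq ∧ rp = rq ∧ sp = sq)
    (hqr : Hq → Hr → X) (hqs : Hq → Hs → X) (hrs' : Hr → Hs → X) : X := by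
  -- The proposition `E` stands for `p = q`, where `pqrs` yields no Pell unit but `√p` already gives
  -- the class of `q`.
  by_cases h : E
  all_goals
    simp only [h, not_true_eq_false, not_false_eq_true, false_implies, true_implies] at h4 hE
    rcases hrp with rfl | rfl <;> rcases hsp with rfl | rfl <;> rcases hrq with rfl | rfl <;>
    rcases hsq with rfl | rfl <;> rcases hrs with rfl | rfl <;>
    rcases he with ⟨rfl, rfl⟩ | ⟨rfl, rfl⟩ <;>
    simp at hC h3 h4 hE <;> tauto

end Polya

theorem theorem1p2 (p q r s : ℕ) [Fact p.Prime] [Fact q.Prime] [Fact r.Prime] [Fact s.Prime]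
    (hp : p % 4 = 3) (hq : q % 4 = 3) (hr : r % 4 = 1) (hs : s % 4 = 1) :
    -- case (i)
    ((legendreSym r 2 = -1 ∧ legendreSym s 2 = -1) →
      -- C1
      ((legendreSym r q = -1 ∧ legendreSym s q = -1 ∧ legendreSym p (r * s) = -1) ∨
      -- C2
       (legendreSym q (r * s) = -1 ∧ legendreSym p r = -1 ∧ legendreSym p s = -1)) →
      IsPolyaField (adjoinSqrts p (q * r * s))) ∧
    -- case (ii)
    ((legendreSym r 2 = 1 ∧ legendreSym s 2 = -1) →
      -- C3
      ((legendreSym s r = -1 ∧ legendreSym s q = -1 ∧ legendreSym p r = -1 ∧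
          legendreSym q r = 1) ∨
      -- C4
       (legendreSym q r = -1 ∧ legendreSym s r = -1 ∧ legendreSym p r = -1 ∧
          legendreSym p s = 1) ∨
      -- C5
       (legendreSym q r = -1 ∧ legendreSym p r = -1 ∧ legendreSym s (p * q) = -1 ∧
          legendreSym s r = 1)) →
      IsPolyaField (adjoinSqrts p (q * r * s))) := by
  have hpP : p.Prime := Fact.out
  have hqP : q.Prime := Fact.out
  have hrP : r.Prime := Fact.out
  have hsP : s.Prime := Fact.out
  have hp2 : p ≠ 2 := by rintro rfl; lia
  have hq2 : q ≠ 2 := by rintro rfl; lia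
  have hs2 : s ≠ 2 := by rintro rfl; lia
  obtain ⟨A, B, hA, hB, -, -⟩ := adjoinSqrts_exists_sq p (q * r * s)
  have hAB : (A * B) ^ 2 = (p * q * r * s : ℕ) := by
    rw [mul_pow, hA, hB, ← Nat.cast_mul]
    congr 1
    ring
  have hH2 : IsSquareUpToUnit (𝓞 (adjoinSqrts p (q * r * s))) 2 := isSquareUpToUnit_two hpP hp hA
  have hHp : IsSquareUpToUnit (𝓞 (adjoinSqrts p (q * r * s))) p := .of_sq_eq hA
  have hHn : IsSquareUpToUnit (𝓞 (adjoinSqrts p (q * r * s))) (q * r * s) := .of_sq_eq hB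
  have hpolya := isPolyaField_adjoinSqrts hpP hqP hrP hsP hp hq hr hs
  have hqr : IsSquareUpToUnit (𝓞 (adjoinSqrts p (q * r * s))) q →
      IsSquareUpToUnit (𝓞 (adjoinSqrts p (q * r * s))) r →
      IsPolyaField (adjoinSqrts p (q * r * s)) := fun h1 h2 =>
    hpolya h1 h2 (.of_mul_left (mul_ne_zero hqP.ne_zero hrP.ne_zero) hHn (h1.mul h2))
  have hqs : IsSquareUpToUnit (𝓞 (adjoinSqrts p (q * r * s))) q →
      IsSquareUpToUnit (𝓞 (adjoinSqrts p (q * r * s))) s →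
      IsPolyaField (adjoinSqrts p (q * r * s)) := fun h1 h2 =>
    hpolya h1 (.of_mul_left (mul_ne_zero hqP.ne_zero hsP.ne_zero)
      (mul_right_comm q r s ▸ hHn) (h1.mul h2)) h2
  have hrs : IsSquareUpToUnit (𝓞 (adjoinSqrts p (q * r * s))) r →
      IsSquareUpToUnit (𝓞 (adjoinSqrts p (q * r * s))) s →
      IsPolyaField (adjoinSqrts p (q * r * s)) := fun h1 h2 =>
    hpolya (.of_mul_right (mul_ne_zero hrP.ne_zero hsP.ne_zero)
      (mul_assoc q r s ▸ hHn) (h1.mul h2)) h1 h2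
  have sgn : ∀ (ℓ t : ℕ) [Fact ℓ.Prime], t.Prime → ℓ ≠ t →
      legendreSym ℓ t = 1 ∨ legendreSym ℓ t = -1 := fun ℓ t _ ht hne =>
    legendreSym.eq_one_or_neg_one ℓ (by
      rw [Int.cast_natCast, Ne, ZMod.natCast_eq_zero_iff,
        Nat.prime_dvd_prime_iff_eq Fact.out ht]
      exact hne)
  have hrp := sgn r p hpP (by rintro rfl; lia)
  have hsp := sgn s p hpP (by rintro rfl; lia)
  have hrq := sgn r q hqP (by rintro rfl; lia)
  have hsq := sgn s q hqP (by rintro rfl; lia)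
  -- Reciprocity turns all symbols into symbols modulo `r` or `s`, the form that the descent
  -- produces.
  rw [legendreSym.mul, legendreSym.mul, legendreSym.mul,
    legendreSym.quadratic_reciprocity_one_mod_four hr hp2,
    legendreSym.quadratic_reciprocity_one_mod_four hs hp2,
    legendreSym.quadratic_reciprocity_one_mod_four hr hq2,
    legendreSym.quadratic_reciprocity_one_mod_four hs hq2,
    legendreSym.quadratic_reciprocity_one_mod_four hr hs2]
  have hK2 := fun h1 h2 => splitting_of_three_primes hq hr hs h1 h2 hB hH2
  have hK3 := fun h1 h2 => splitting_of_four_primes hp hq hr hs h1 h2 hAB hHp hHn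
  simp only [legendreSym.mul, legendreSym.quadratic_reciprocity_one_mod_four hr hs2] at hK2 hK3
  refine ⟨fun ⟨h2r, h2s⟩ hC => ?_, fun ⟨h2r, h2s⟩ hC => ?_⟩
  -- If `r = s`, either condition would equate -1 with the square of a symbol.
  · have hne : r ≠ s := by
      rintro rfl
      rcases hC with ⟨-, -, h⟩ | ⟨h, -, -⟩
      · nlinarith only [h, mul_self_nonneg (legendreSym r p)]
      · nlinarith only [h, mul_self_nonneg (legendreSym r q)]
    have hpq : p ≠ q := by
      rintro rfl
      rcases hC with ⟨h1, h2, h3⟩ | ⟨h3, h1, h2⟩ <;> simp [h1, h2] at h3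
    have hsr := sgn r s hsP hne
    obtain ⟨e, he, h2⟩ := hK2 hne h2s
    have h3 := hK3 hpq hne
    refine of_symbols_of_both_inert hrp hsp hrq hsq hsr ?_ hC h2 h3 hqr hqs hrs
    rcases he with rfl | rfl <;> simp [h2r, h2s]
  · have hne : r ≠ s := by
      rintro rfl
      lia
    have hsr := sgn r s hsP hne
    obtain ⟨e, he, h2⟩ := hK2 hne h2s
    have h3 := fun h => hK3 h hne
    refine of_symbols_of_split_of_inert hrp hsp hrq hsq hsr ?_ hC h2 h3
      (fun h => ⟨h ▸ hHp, by rw [h], by rw [h]⟩) hqr hqs hrs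
    rcases he with rfl | rfl <;> simp [h2r, h2s]
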